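/- Let $d\ge 1$ be an integer and $0<s<\frac d2$. There is a constant $c>0$ depending only on $d$ and $s$ such that for all $v\in\dot H^s(\mathbb R^d)$, all integers $K\ge 1$ and all $R=(R_1,\dots,R_K)\in\mathbb R^{dK}$, $$ \|(-\Delta)^{s/2}v\|_{L^2(\mathbb R^d)}^2 \;\ge\; c\,K^{-\frac{2s}{d}}\int_{\mathbb R^d}\frac{|v(x)|^2}{\delta_R(x)^{2s}}\,dx , \qquad \delta_R(x):=\min_{1\le k\le K}|x-R_k| . $$ (In particular the integral on the right side is finite.) Here $(-\Delta)^{s/2}$ acts as multiplication by $|\xi|^s$ in Fourier space, and $\dot H^s(\mathbb R^d)$ is the completion of $C_c^\infty(\mathbb R^d)$ (complex-valued functions) with respect to the norm $\|(-\Delta)^{s/2}v\|_{L^2(\mathbb R^d)}$, realized as a space of functions: $v$ belongs to it if $v$ is locally integrable and is the $L^1_{\rm loc}$-limit of a sequence $(\varphi_n)$ in $C_c^\infty(\mathbb R^d)$ that is Cauchy with respect to this norm, and then $(-\Delta)^{s/2}v$ is the $L^2$-limit of $(-\Delta)^{s/2}\varphi_n$. -/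

import Mathlib

open MeasureTheory Filter Topology
open scoped SchwartzMap FourierTransform ENNReal

/-- For a Schwartz function `φ` and `s ≥ 0`, the function `ξ ↦ (2π|ξ|)^s φ̂(ξ)` is in `L²`. -/
theorem memLp_fracSymbol_mul_fourier {d : ℕ} {s : ℝ} (hs : 0 ≤ s)
    (φ : 𝓢(EuclideanSpace ℝ (Fin d), ℂ)) :
    MemLp (fun ξ : EuclideanSpace ℝ (Fin d) =>
      (((2 * Real.pi * ‖ξ‖) ^ s : ℝ) : ℂ) * (𝓕 φ) ξ) 2 volume := by
  have hg : Function.HasTemperateGrowth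
      (fun ξ : EuclideanSpace ℝ (Fin d) => (((1 + ‖ξ‖ ^ 2) ^ (s / 2) : ℝ) : ℂ)) := by
    fun_prop
  have h1 := (SchwartzMap.smulLeftCLM ℂ
    (fun ξ : EuclideanSpace ℝ (Fin d) => (((1 + ‖ξ‖ ^ 2) ^ (s / 2) : ℝ) : ℂ)) (𝓕 φ)).memLp
      2 volume
  refine (h1.const_mul (((2 * Real.pi) ^ s : ℝ) : ℂ)).mono ?_ (ae_of_all _ fun ξ => ?_)
  · have : Continuous (fun ξ : EuclideanSpace ℝ (Fin d) => (2 * Real.pi * ‖ξ‖) ^ s) :=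
      (continuous_const.mul continuous_norm).rpow_const fun _ => Or.inr hs
    exact ((Complex.continuous_ofReal.comp this).mul (𝓕 φ).continuous).aestronglyMeasurable
  · rw [SchwartzMap.smulLeftCLM_apply_apply hg, smul_eq_mul]
    simp only [norm_mul, Complex.norm_real, Real.norm_eq_abs]
    rw [← mul_assoc]
    refine mul_le_mul_of_nonneg_right ?_ (norm_nonneg _)
    rw [abs_of_nonneg (by positivity), abs_of_nonneg (by positivity),
      abs_of_nonneg (by positivity), Real.mul_rpow (by positivity) (norm_nonneg _)]
    refine mul_le_mul_of_nonneg_left ?_ (by positivity)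
    have h2 : ‖ξ‖ ^ s = (‖ξ‖ ^ 2) ^ (s / 2) := by
      rw [← Real.rpow_natCast, ← Real.rpow_mul (norm_nonneg _)]
      congr 1
      push_cast
      ring
    rw [h2]
    exact Real.rpow_le_rpow (by positivity) (by linarith) (by linarith)

/-- The fractional Laplacian `(-Δ)^{s/2} φ ∈ L²(ℝ^d)` of a Schwartz function: multiplication by
`|k|^s` in Fourier space. In the normalization `φ̂(ξ) = ∫ e^{-2πi ξ·x} φ(x) dx` used here the
frequency is `k = 2πξ`. -/
noncomputable def fracLaplacianSchwartz {d : ℕ} {s : ℝ} (hs : 0 ≤ s)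
    (φ : 𝓢(EuclideanSpace ℝ (Fin d), ℂ)) :
    Lp ℂ 2 (volume : Measure (EuclideanSpace ℝ (Fin d))) :=
  𝓕⁻ ((memLp_fracSymbol_mul_fourier hs φ).toLp _)

/-- The sequence `φ` of functions in `C_c^∞(ℝ^d)` converges in `L¹_loc(ℝ^d)` to the locally
integrable function `v`. -/
def TestConvergesLocally {d : ℕ} (φ : ℕ → 𝓢(EuclideanSpace ℝ (Fin d), ℂ))
    (v : EuclideanSpace ℝ (Fin d) → ℂ) : Prop :=
  (∀ n, HasCompactSupport (φ n)) ∧ LocallyIntegrable v volume ∧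
    ∀ S : Set (EuclideanSpace ℝ (Fin d)), IsCompact S →
      Tendsto (fun n => ∫⁻ x in S, ‖φ n x - v x‖ₑ) atTop (𝓝 0)

/-- `v ∈ Ḣ^s(ℝ^d)` for `0 < s < d/2`. The space is the completion of `C_c^∞(ℝ^d)` for the norm
`φ ↦ ‖(-Δ)^{s/2} φ‖_{L²}`, realized as a space of functions: `v` is the `L¹_loc` limit of a sequence
in `C_c^∞(ℝ^d)` which is Cauchy for this norm. -/
def MemHomSobolev {d : ℕ} {s : ℝ} (hs : 0 ≤ s) (v : EuclideanSpace ℝ (Fin d) → ℂ) : Prop :=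
  ∃ φ : ℕ → 𝓢(EuclideanSpace ℝ (Fin d), ℂ), TestConvergesLocally φ v ∧
    CauchySeq fun n => fracLaplacianSchwartz hs (φ n)

/-- `g = (-Δ)^{s/2} v` for `v ∈ Ḣ^s(ℝ^d)`: the extension by continuity of the operator
`(-Δ)^{s/2}` from `C_c^∞(ℝ^d)` to the completion, with values in `L²(ℝ^d)`. -/
def IsFracLaplacian {d : ℕ} {s : ℝ} (hs : 0 ≤ s) (v : EuclideanSpace ℝ (Fin d) → ℂ)
    (g : Lp ℂ 2 (volume : Measure (EuclideanSpace ℝ (Fin d)))) : Prop :=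
  ∃ φ : ℕ → 𝓢(EuclideanSpace ℝ (Fin d), ℂ), TestConvergesLocally φ v ∧
    Tendsto (fun n => fracLaplacianSchwartz hs (φ n)) atTop (𝓝 g)

/-- The functions in `Ḣ^s` are exactly those for which `(-Δ)^{s/2} v` exists in `L²`. -/
theorem memHomSobolev_iff {d : ℕ} {s : ℝ} (hs : 0 ≤ s) (v : EuclideanSpace ℝ (Fin d) → ℂ) :
    MemHomSobolev hs v ↔ ∃ g, IsFracLaplacian hs v g := by
  constructor
  · rintro ⟨φ, h, hc⟩
    obtain ⟨g, hg⟩ := cauchySeq_tendsto_of_complete hc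
    exact ⟨g, φ, h, hg⟩
  · rintro ⟨g, φ, h, hg⟩
    exact ⟨φ, h, hg.cauchySeq⟩

/-- The distance `δ_R(x) = min_k |x - R_k|` from `x` to the nearest of the points
`R_1, …, R_K` (used for `K ≥ 1`). -/
noncomputable def nearestDist {d K : ℕ} (R : Fin K → EuclideanSpace ℝ (Fin d))
    (x : EuclideanSpace ℝ (Fin d)) : ℝ :=
  ⨅ k, ‖x - R k‖

/-! Let l be such that {δ ≤ r} has measure at most (r/l)^d; this is all that is used about the
points, up to δ > 0 a.e. By the layer-cake formula, ∫ |φ|²/δ^{2s} is 2s times the integral over r >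
0 of r^{-2s-1} ∫_{δ ≤ r} |φ|². At scale r, split the frequencies at l/r. The high part is controlled
in L² by Plancherel. The low part is bounded in sup norm by the L¹ norm of φ̂ on a ball of radius
2l/r, hence by Cauchy-Schwarz with weight |ξ|^{2t}, and the measure bound is spent here.

Tonelli then integrates over r for fixed ξ: r^{-2s-1} over r ≥ l/|ξ| and r^{2t-2s-1} over r < 2l/|ξ|
both give multiples of l^{-2s}|ξ|^{2s}, after the factor l^{-2t} of the low part. A union of K balls
allows l = (Kω)^{-1/d}, with ω the volume of the unit ball, so l^{-2s} gives K^{2s/d}. Fatou's lemma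
passes from test functions to v. The core is `exists_hardy_schwartz`. -/

/-! ### Frequency splitting and weighted Cauchy-Schwarz -/

section

variable {V : Type*} [NormedAddCommGroup V] [InnerProductSpace ℝ V] [FiniteDimensional ℝ V]
  [MeasurableSpace V] [BorelSpace V]

/-- Plancherel's theorem for Schwartz functions, in terms of lower Lebesgue integrals. -/
theorem lintegral_enorm_sq_fourierInv (f : 𝓢(V, ℂ)) :
    ∫⁻ x, ‖(𝓕⁻ f) x‖ₑ ^ 2 = ∫⁻ ξ, ‖f ξ‖ₑ ^ 2 := by
  have key (g : 𝓢(V, ℂ)) : ∫⁻ x, ‖g x‖ₑ ^ 2 = ENNReal.ofReal (∫ x, ‖g x‖ ^ 2) := by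
    rw [ofReal_integral_eq_lintegral_ofReal]
    · refine lintegral_congr fun x => ?_
      rw [ENNReal.ofReal_pow (norm_nonneg _), ofReal_norm]
    · exact (memLp_two_iff_integrable_sq_norm g.continuous.aestronglyMeasurable).1
        (g.memLp 2 volume)
    · exact ae_of_all _ fun x => by positivity
  have h := SchwartzMap.integral_norm_sq_fourier (𝓕⁻ f)
  rw [FourierTransform.fourier_fourierInv_eq] at h
  rw [key, key, h]

theorem enorm_fourierInv_le (f : 𝓢(V, ℂ)) (x : V) : ‖(𝓕⁻ f) x‖ₑ ≤ ∫⁻ ξ, ‖f ξ‖ₑ := by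
  rw [SchwartzMap.fourierInv_coe, Real.fourierInv_eq]
  refine (enorm_integral_le_lintegral_enorm _).trans (lintegral_mono fun ξ => ?_)
  rw [Circle.smul_def, enorm_smul]
  simp only [← ofReal_norm, Circle.norm_coe, ENNReal.ofReal_one, one_mul, le_refl]

/-- Splitting a Schwartz function into a low-frequency and a high-frequency part. -/
theorem exists_frequency_splitting (φ : 𝓢(V, ℂ)) {ρ : ℝ} (hρ : 0 < ρ) :
    ∃ u w : 𝓢(V, ℂ), φ = u + w ∧
      (∀ x, ‖u x‖ₑ ≤ ∫⁻ ξ in Metric.ball 0 (2 * ρ), ‖(𝓕 φ) ξ‖ₑ) ∧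
      ∫⁻ x, ‖w x‖ₑ ^ 2 ≤ ∫⁻ ξ in {ξ | ρ ≤ ‖ξ‖}, ‖(𝓕 φ) ξ‖ₑ ^ 2 := by
  -- The cutoff is smooth, so both pieces stay Schwartz; the price is the overlap ρ ≤ |ξ| < 2ρ of
  -- the two frequency regions.
  let χ : ContDiffBump (0 : V) := ⟨ρ, 2 * ρ, hρ, by linarith⟩
  have hχ : Function.HasTemperateGrowth (fun ξ => ((χ ξ : ℝ) : ℂ)) := by
    refine HasCompactSupport.hasTemperateGrowth ?_ ?_
    · exact χ.hasCompactSupport.comp_left (g := fun r : ℝ => (r : ℂ)) (by simp)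
    · exact Complex.ofRealCLM.contDiff.comp χ.contDiff
  let a : 𝓢(V, ℂ) := SchwartzMap.smulLeftCLM ℂ (fun ξ => ((χ ξ : ℝ) : ℂ)) (𝓕 φ)
  have ha (ξ : V) : a ξ = (χ ξ : ℂ) * (𝓕 φ) ξ := by
    simp only [a, SchwartzMap.smulLeftCLM_apply_apply hχ, smul_eq_mul]
  refine ⟨𝓕⁻ a, 𝓕⁻ (𝓕 φ - a), ?_, fun x => ?_, ?_⟩
  · rw [← FourierTransform.fourierInv_add, add_sub_cancel, FourierTransform.fourierInv_fourier_eq]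
  · refine (enorm_fourierInv_le a x).trans ?_
    rw [← lintegral_indicator measurableSet_ball]
    refine lintegral_mono fun ξ => ?_
    by_cases hξ : ξ ∈ Metric.ball (0 : V) (2 * ρ)
    · rw [Set.indicator_of_mem hξ, ha, enorm_mul]
      refine mul_le_of_le_one_left' ?_
      rw [← ofReal_norm, Complex.norm_real, Real.norm_of_nonneg χ.nonneg]
      exact ENNReal.ofReal_le_one.2 χ.le_one
    · rw [Set.indicator_of_notMem hξ, ha, χ.zero_of_le_dist (by simpa using hξ)]
      simp
  · rw [lintegral_enorm_sq_fourierInv,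
      ← lintegral_indicator (measurableSet_le measurable_const measurable_norm)]
    refine lintegral_mono fun ξ => ?_
    by_cases hξ : ξ ∈ {ξ : V | ρ ≤ ‖ξ‖}
    · rw [Set.indicator_of_mem hξ]
      gcongr
      rw [sub_apply, ha, ← one_sub_mul, enorm_mul]
      refine mul_le_of_le_one_left' ?_
      rw [← ofReal_norm, ← Complex.ofReal_one, ← Complex.ofReal_sub, Complex.norm_real,
        Real.norm_of_nonneg (sub_nonneg.2 χ.le_one)]
      exact ENNReal.ofReal_le_one.2 (by linarith [χ.nonneg' ξ])
    · rw [Set.indicator_of_notMem hξ, sub_apply, ha, χ.one_of_mem_closedBall]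
      · simp
      · have : ‖ξ‖ < ρ := by simpa using hξ
        simpa using this.le

/-- Integrability of `‖x‖ ^ (-a)` at the origin, with its scaling in the radius. -/
theorem exists_lintegral_ball_norm_rpow_le {a : ℝ} (ha0 : 0 ≤ a) (ha : a < Module.finrank ℝ V) :
    ∃ C : ℝ, 0 < C ∧ ∀ r : ℝ, 0 < r →
      ∫⁻ x in Metric.ball (0 : V) r, ENNReal.ofReal (‖x‖ ^ (-a)) ≤
        ENNReal.ofReal (C * r ^ (Module.finrank ℝ V - a)) := by
  have hd : 0 < Module.finrank ℝ V := by exact_mod_cast ha0.trans_lt ha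
  have : Nontrivial V := Module.finrank_pos_iff.1 hd
  have hint (r : ℝ) (hr : 0 < r) :
      IntegrableOn (fun x : V => ‖x‖ ^ (-a)) (Metric.ball (0 : V) r) := by
    refine (integrableOn_fun_norm_addHaar volume (f := fun y : ℝ => y ^ (-a))).2 ?_
    have h1 : IntegrableOn (fun y : ℝ => y ^ ((Module.finrank ℝ V : ℝ) - 1 - a)) (Set.Ioo 0 r) :=
      (intervalIntegral.integrableOn_Ioo_rpow_iff hr).2 (by linarith)
    refine h1.congr_fun (fun y hy => ?_) measurableSet_Ioo
    simp only [smul_eq_mul]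
    rw [← Real.rpow_natCast, ← Real.rpow_add hy.1, Nat.cast_sub hd]
    congr 1
    push_cast
    ring
  have hnn (s : Set V) : 0 ≤ ∫ x in s, ‖x‖ ^ (-a) :=
    integral_nonneg fun x => by positivity
  -- Adding 1 gives a positive constant without bounding the integral from below.
  refine ⟨(∫ x in Metric.ball (0 : V) 1, ‖x‖ ^ (-a)) + 1, by linarith [hnn (Metric.ball 0 1)],
    fun r hr => ?_⟩
  rw [← ofReal_integral_eq_lintegral_ofReal (hint r hr) (ae_of_all _ fun x => by positivity)]
  refine ENNReal.ofReal_le_ofReal ?_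
  have h2 := Measure.setIntegral_comp_smul_of_pos (volume : Measure V) (fun x : V => ‖x‖ ^ (-a))
    (Metric.ball (0 : V) 1) hr
  rw [smul_unitBall_of_pos hr] at h2
  have h3 : ∫ x in Metric.ball (0 : V) 1, ‖r • x‖ ^ (-a) =
      r ^ (-a) * ∫ x in Metric.ball (0 : V) 1, ‖x‖ ^ (-a) := by
    rw [← integral_const_mul]
    refine integral_congr_ae (ae_of_all _ fun x => ?_)
    simp only [norm_smul, Real.norm_of_nonneg hr.le]
    exact Real.mul_rpow hr.le (norm_nonneg _)
  rw [h3, smul_eq_mul, eq_inv_mul_iff_mul_eq₀ (by positivity)] at h2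
  rw [← h2, sub_eq_add_neg, Real.rpow_add hr, Real.rpow_natCast]
  have : 0 < r ^ Module.finrank ℝ V * r ^ (-a) := by positivity
  nlinarith

/-- Cauchy-Schwarz with a power weight on a ball. -/
theorem exists_sq_lintegral_ball_le {t : ℝ} (ht0 : 0 ≤ t) (ht : 2 * t < Module.finrank ℝ V) :
    ∃ C : ℝ, 0 < C ∧ ∀ f : V → ℝ≥0∞, Measurable f → ∀ r : ℝ, 0 < r →
      (∫⁻ x in Metric.ball (0 : V) r, f x) ^ 2 ≤
        ENNReal.ofReal (C * r ^ (Module.finrank ℝ V - 2 * t)) *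
          ∫⁻ x in Metric.ball (0 : V) r, f x ^ 2 * ENNReal.ofReal (‖x‖ ^ (2 * t)) := by
  have hd : 0 < Module.finrank ℝ V := by exact_mod_cast (by positivity : 0 ≤ 2 * t).trans_lt ht
  have : Nontrivial V := Module.finrank_pos_iff.1 hd
  obtain ⟨C, hC, h⟩ := exists_lintegral_ball_norm_rpow_le (V := V) (a := 2 * t) (by positivity) ht
  refine ⟨C, hC, fun f hf r hr => ?_⟩
  have hsq (x : V) (b : ℝ) : ENNReal.ofReal (‖x‖ ^ b) ^ 2 = ENNReal.ofReal (‖x‖ ^ (2 * b)) := by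
    rw [← ENNReal.ofReal_pow (by positivity), ← Real.rpow_natCast, ← Real.rpow_mul (norm_nonneg _)]
    congr 2
    push_cast
    ring
  have hm (b : ℝ) : Measurable fun x : V => ENNReal.ofReal (‖x‖ ^ b) := by fun_prop
  have h1 := ENNReal.lintegral_mul_le_Lp_mul_Lq (volume.restrict (Metric.ball (0 : V) r))
    Real.HolderConjugate.two_two (hf.mul (hm t)).aemeasurable (hm (-t)).aemeasurable
  have h2 : ∫⁻ x in Metric.ball (0 : V) r, f x ≤ ∫⁻ x in Metric.ball (0 : V) r,
      f x * ENNReal.ofReal (‖x‖ ^ t) * ENNReal.ofReal (‖x‖ ^ (-t)) := by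
    -- The origin is excluded because there the two weights multiply to 0 instead of 1 when t ≠ 0.
    refine lintegral_mono_ae (ae_restrict_of_ae ?_)
    filter_upwards [compl_mem_ae_iff.2 (measure_singleton (0 : V))] with x hx
    have hx' : 0 < ‖x‖ := norm_pos_iff.2 hx
    rw [mul_assoc, ← ENNReal.ofReal_mul (by positivity), ← Real.rpow_add hx']
    simp
  have hroot (b : ℝ≥0∞) : (b ^ (1 / 2 : ℝ)) ^ 2 = b := by
    rw [← ENNReal.rpow_natCast, ← ENNReal.rpow_mul]
    norm_num
  refine (pow_le_pow_left' (h2.trans h1) 2).trans ?_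
  rw [mul_pow, hroot, hroot, mul_comm]
  simp only [Pi.mul_apply, ENNReal.rpow_ofNat, mul_pow, hsq, mul_neg]
  gcongr
  exact h r hr

end

/-! ### Integration over scales and the layer-cake formula -/

theorem lintegral_Ici_rpow {a b : ℝ} (ha : a < -1) (hb : 0 < b) :
    ∫⁻ r in Set.Ici b, ENNReal.ofReal (r ^ a) = ENNReal.ofReal (b ^ (a + 1) / (-a - 1)) := by
  rw [setLIntegral_congr Ioi_ae_eq_Ici.symm, ← ofReal_integral_eq_lintegral_ofReal
    (integrableOn_Ioi_rpow_of_lt ha hb), integral_Ioi_rpow_of_lt ha hb]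
  · congr 1
    rw [neg_div, ← div_neg]
    congr 1
    ring
  · filter_upwards [ae_restrict_mem measurableSet_Ioi] with r hr
    exact Real.rpow_nonneg (hb.trans hr).le _

theorem lintegral_Ioo_rpow {a b : ℝ} (ha : -1 < a) (hb : 0 < b) :
    ∫⁻ r in Set.Ioo 0 b, ENNReal.ofReal (r ^ a) = ENNReal.ofReal (b ^ (a + 1) / (a + 1)) := by
  rw [← ofReal_integral_eq_lintegral_ofReal
    ((intervalIntegral.integrableOn_Ioo_rpow_iff hb).2 ha), ← integral_Ioc_eq_integral_Ioo,
    ← intervalIntegral.integral_of_le hb.le, integral_rpow (Or.inl ha),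
    Real.zero_rpow (by linarith), sub_zero]
  filter_upwards [ae_restrict_mem measurableSet_Ioo] with r hr
  exact Real.rpow_nonneg hr.1.le _

section

variable {α : Type*} [MeasurableSpace α] {μ : Measure α} [SFinite μ]

theorem measurable_setLIntegral_section {f : α → ℝ≥0∞} (hf : Measurable f) {S : Set (ℝ × α)}
    (hS : MeasurableSet S) : Measurable fun r => ∫⁻ x in {x | (r, x) ∈ S}, f x ∂μ := by
  have h : Measurable fun r => ∫⁻ x, S.indicator (fun p => f p.2) (r, x) ∂μ :=
    ((hf.comp measurable_snd).indicator hS).lintegral_prod_right'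
  convert h using 2 with r
  exact (lintegral_indicator (measurable_prodMk_left hS) _).symm

/-- Tonelli's theorem for a weight `g` on the scales `r > 0` and a measurable relation between
scales and points. -/
theorem lintegral_scale_mul_setLIntegral {g : ℝ → ℝ≥0∞} (hg : Measurable g) {f : α → ℝ≥0∞}
    (hf : Measurable f) {S : Set (ℝ × α)} (hS : MeasurableSet S) :
    ∫⁻ r in Set.Ioi 0, g r * ∫⁻ x in {x | (r, x) ∈ S}, f x ∂μ =
      ∫⁻ x, f x * (∫⁻ r in {r | 0 < r ∧ (r, x) ∈ S}, g r) ∂μ := by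
  have h1 (r : ℝ) : MeasurableSet {x | (r, x) ∈ S} := measurable_prodMk_left hS
  have h2 (x : α) : MeasurableSet {r | (r, x) ∈ S} := measurable_prodMk_right hS
  calc ∫⁻ r in Set.Ioi 0, g r * ∫⁻ x in {x | (r, x) ∈ S}, f x ∂μ
      = ∫⁻ r in Set.Ioi (0 : ℝ), ∫⁻ x, S.indicator (fun p => g p.1 * f p.2) (r, x) ∂μ := by
        refine lintegral_congr fun r => ?_
        rw [← lintegral_indicator (h1 r), ← lintegral_const_mul _ (hf.indicator (h1 r))]
        refine lintegral_congr fun x => ?_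
        by_cases h : (r, x) ∈ S <;> simp [h]
    _ = ∫⁻ x, (∫⁻ r in Set.Ioi (0 : ℝ), S.indicator (fun p => g p.1 * f p.2) (r, x)) ∂μ :=
        lintegral_lintegral_swap
          (((hg.comp measurable_fst).mul (hf.comp measurable_snd)).indicator hS).aemeasurable
    _ = ∫⁻ x, f x * (∫⁻ r in {r | 0 < r ∧ (r, x) ∈ S}, g r) ∂μ := by
        refine lintegral_congr fun x => ?_
        have h3 : {r | 0 < r ∧ (r, x) ∈ S} = {r | (r, x) ∈ S} ∩ Set.Ioi 0 := by
          ext r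
          simp [and_comm]
        rw [h3, ← Measure.restrict_restrict (h2 x), ← lintegral_indicator (h2 x),
          ← lintegral_const_mul _ (hg.indicator (h2 x))]
        refine lintegral_congr fun r => ?_
        by_cases h : (r, x) ∈ S <;> simp [h, mul_comm]

/-- Layer-cake formula for the weight `δ ^ (-2s)`. -/
theorem lintegral_div_rpow_le {s : ℝ} (hs : 0 < s) {δ : α → ℝ} (hδ : Measurable δ)
    (hδ0 : ∀ᵐ x ∂μ, 0 < δ x) {f : α → ℝ≥0∞} (hf : Measurable f) :
    ∫⁻ x, f x / ENNReal.ofReal (δ x ^ (2 * s)) ∂μ ≤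
      ENNReal.ofReal (2 * s) * ∫⁻ r in Set.Ioi 0, ENNReal.ofReal (r ^ (-2 * s - 1)) *
        ∫⁻ x in {x | δ x ≤ r}, f x ∂μ := by
  have hS : MeasurableSet {p : ℝ × α | δ p.2 ≤ p.1} :=
    measurableSet_le (hδ.comp measurable_snd) measurable_fst
  have h := lintegral_scale_mul_setLIntegral (μ := μ)
    (g := fun r => ENNReal.ofReal (r ^ (-2 * s - 1))) (by fun_prop) hf hS
  simp only [Set.mem_ofPred_eq] at h
  rw [h, ← lintegral_const_mul' _ _ ENNReal.ofReal_ne_top]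
  refine lintegral_mono_ae ?_
  filter_upwards [hδ0] with x hx
  have h1 : {r | 0 < r ∧ δ x ≤ r} = Set.Ici (δ x) := by
    ext r
    simp only [Set.mem_ofPred_eq, Set.mem_Ici, and_iff_right_iff_imp]
    exact hx.trans_le
  rw [h1, lintegral_Ici_rpow (by linarith) hx, mul_left_comm, ← ENNReal.ofReal_mul (by positivity),
    div_eq_mul_inv, ← ENNReal.ofReal_inv_of_pos (by positivity), ← Real.rpow_neg hx.le]
  refine le_of_eq ?_
  congr 2
  rw [show -2 * s - 1 + 1 = -(2 * s) by ring]
  field_simp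
  ring

end

/-! ### Hardy inequality for Schwartz functions -/

theorem enorm_add_sq_le (a b : ℂ) : ‖a + b‖ₑ ^ 2 ≤ 2 * ‖a‖ₑ ^ 2 + 2 * ‖b‖ₑ ^ 2 := by
  rw [← mul_add]
  simp only [← ofReal_norm]
  rw [← ENNReal.ofReal_pow (norm_nonneg _), ← ENNReal.ofReal_pow (norm_nonneg _),
    ← ENNReal.ofReal_pow (norm_nonneg _), ← ENNReal.ofReal_add (by positivity) (by positivity),
    ← ENNReal.ofReal_ofNat 2, ← ENNReal.ofReal_mul (by positivity)]
  refine ENNReal.ofReal_le_ofReal ?_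
  have h := norm_add_le a b
  nlinarith [norm_nonneg (a + b), norm_nonneg a, norm_nonneg b, sq_nonneg (‖a‖ - ‖b‖)]

section

variable {V : Type*} [NormedAddCommGroup V] [InnerProductSpace ℝ V] [FiniteDimensional ℝ V]
  [MeasurableSpace V] [BorelSpace V]

/-- The `L²` mass of a Schwartz function on a set of finite measure, bounded by splitting the
frequencies at `ρ`. -/
theorem exists_setLIntegral_enorm_sq_le {t : ℝ} (ht0 : 0 ≤ t) (ht : 2 * t < Module.finrank ℝ V) :
    ∃ C : ℝ, 0 < C ∧ ∀ φ : 𝓢(V, ℂ), ∀ (D : Set V) (ρ : ℝ), 0 < ρ →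
      ∫⁻ x in D, ‖φ x‖ₑ ^ 2 ≤ 2 * (∫⁻ ξ in {ξ | ρ ≤ ‖ξ‖}, ‖(𝓕 φ) ξ‖ₑ ^ 2) +
        ENNReal.ofReal (C * ρ ^ (Module.finrank ℝ V - 2 * t)) * volume D *
          ∫⁻ ξ in Metric.ball 0 (2 * ρ), ‖(𝓕 φ) ξ‖ₑ ^ 2 * ENNReal.ofReal (‖ξ‖ ^ (2 * t)) := by
  obtain ⟨C, hC, h⟩ := exists_sq_lintegral_ball_le (V := V) ht0 ht
  -- The outer 2 comes from |a + b|² ≤ 2|a|² + 2|b|², the power of 2 from the radius 2ρ of the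
  -- low-frequency ball.
  refine ⟨2 * (C * 2 ^ (Module.finrank ℝ V - 2 * t)), by positivity, fun φ D ρ hρ => ?_⟩
  obtain ⟨u, w, huw, hu, hw⟩ := exists_frequency_splitting φ hρ
  have hF : Measurable fun ξ => ‖(𝓕 φ) ξ‖ₑ := (𝓕 φ).continuous.measurable.enorm
  have hCS := h _ hF (2 * ρ) (by positivity)
  calc ∫⁻ x in D, ‖φ x‖ₑ ^ 2
      ≤ ∫⁻ x in D, (2 * ‖u x‖ₑ ^ 2 + 2 * ‖w x‖ₑ ^ 2) := by
        refine lintegral_mono fun x => ?_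
        rw [huw, add_apply]
        exact enorm_add_sq_le _ _
    _ = 2 * (∫⁻ x in D, ‖u x‖ₑ ^ 2) + 2 * ∫⁻ x in D, ‖w x‖ₑ ^ 2 := by
        have hmu := u.continuous.measurable.enorm
        have hmw := w.continuous.measurable.enorm
        rw [lintegral_add_left (by fun_prop), lintegral_const_mul _ (by fun_prop),
          lintegral_const_mul _ (by fun_prop)]
    _ ≤ 2 * ((∫⁻ ξ in Metric.ball (0 : V) (2 * ρ), ‖(𝓕 φ) ξ‖ₑ) ^ 2 * volume D) +
        2 * ∫⁻ ξ in {ξ | ρ ≤ ‖ξ‖}, ‖(𝓕 φ) ξ‖ₑ ^ 2 := by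
        gcongr 2 * ?_ + 2 * ?_
        · rw [← setLIntegral_const]
          gcongr with x
          exact hu x
        · exact (setLIntegral_le_lintegral _ _).trans hw
    _ ≤ _ := by
        rw [add_comm]
        gcongr 2 * ?_ + ?_
        · exact le_rfl
        · rw [Real.mul_rpow (by positivity) hρ.le, ← mul_assoc] at hCS
          rw [mul_assoc 2, ENNReal.ofReal_mul (by positivity), ENNReal.ofReal_ofNat,
            mul_assoc, mul_assoc, mul_comm (volume D), ← mul_assoc (ENNReal.ofReal _)]
          gcongr

/-- Fractional Hardy inequality for Schwartz functions, with a weight `δ ^ (-2s)` such that the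
sublevel sets `{δ ≤ r}` have measure at most `λ ^ (-d) r ^ d`. -/
theorem exists_hardy_schwartz {s : ℝ} (hs : 0 < s) (hsd : 2 * s < Module.finrank ℝ V) :
    ∃ C : ℝ, 0 < C ∧ ∀ (δ : V → ℝ), Measurable δ → (∀ᵐ x, 0 < δ x) → ∀ l : ℝ, 0 < l →
      (∀ r : ℝ, 0 < r →
        volume {x | δ x ≤ r} ≤ ENNReal.ofReal ((r / l) ^ (Module.finrank ℝ V : ℝ))) →
      ∀ φ : 𝓢(V, ℂ), ∫⁻ x, ‖φ x‖ₑ ^ 2 / ENNReal.ofReal (δ x ^ (2 * s)) ≤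
        ENNReal.ofReal (C * l ^ (-(2 * s))) *
          ∫⁻ ξ, ‖(𝓕 φ) ξ‖ₑ ^ 2 * ENNReal.ofReal (‖ξ‖ ^ (2 * s)) := by
  -- t < d/2 makes |ξ|^{-2t} integrable at the origin; t > s makes the low-frequency integral over r
  -- converge at r = 0. The midpoint of s and d/2 serves.
  obtain ⟨t, hst, htd⟩ : ∃ t, s < t ∧ 2 * t < Module.finrank ℝ V :=
    ⟨(s + Module.finrank ℝ V / 2) / 2, by linarith, by linarith⟩
  obtain ⟨C, hC, h⟩ := exists_setLIntegral_enorm_sq_le (V := V) (hs.trans hst).le htd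
  have hts : 0 < 2 * t - 2 * s := by linarith
  have : Nontrivial V :=
    Module.finrank_pos_iff.1 (by exact_mod_cast (by positivity : 0 < 2 * s).trans hsd)
  -- The first summand is the high-frequency contribution, the second the low-frequency one.
  refine ⟨2 + 2 * s * C * 2 ^ (2 * t - 2 * s) / (2 * t - 2 * s), by positivity,
    fun δ hδ hδ0 l hl hvol φ => ?_⟩
  have hF : Measurable fun ξ => ‖(𝓕 φ) ξ‖ₑ ^ 2 := ((𝓕 φ).continuous.measurable.enorm).pow_const 2
  have hφ : Measurable fun ξ => ‖φ ξ‖ₑ ^ 2 := (φ.continuous.measurable.enorm).pow_const 2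
  have hFt : Measurable fun ξ => ‖(𝓕 φ) ξ‖ₑ ^ 2 * ENNReal.ofReal (‖ξ‖ ^ (2 * t)) := by fun_prop
  let S₁ : Set (ℝ × V) := {p | l ≤ p.1 * ‖p.2‖}
  let S₂ : Set (ℝ × V) := {p | p.1 * ‖p.2‖ < 2 * l}
  have hS₁ : MeasurableSet S₁ := measurableSet_le (by fun_prop) (by fun_prop)
  have hS₂ : MeasurableSet S₂ := measurableSet_lt (by fun_prop) (by fun_prop)
  have hg (a : ℝ) : Measurable fun r : ℝ => ENNReal.ofReal (r ^ a) := by fun_prop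
  have hT₁ := lintegral_scale_mul_setLIntegral (μ := (volume : Measure V)) (hg (-2 * s - 1)) hF hS₁
  have hT₂ := lintegral_scale_mul_setLIntegral (μ := (volume : Measure V))
    (hg (2 * t - 2 * s - 1)) hFt hS₂
  set J := ∫⁻ ξ, ‖(𝓕 φ) ξ‖ₑ ^ 2 * ENNReal.ofReal (‖ξ‖ ^ (2 * s)) with hJ
  have hne : ∀ᵐ ξ : V, 0 < ‖ξ‖ := by
    filter_upwards [compl_mem_ae_iff.2 (measure_singleton (0 : V))] with ξ hξ
    exact norm_pos_iff.2 hξ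
  have hI₁ : ∫⁻ r in Set.Ioi 0, ENNReal.ofReal (r ^ (-2 * s - 1)) *
      ∫⁻ ξ in {ξ | (r, ξ) ∈ S₁}, ‖(𝓕 φ) ξ‖ₑ ^ 2 = ENNReal.ofReal (l ^ (-(2 * s)) / (2 * s)) * J := by
    rw [hT₁, hJ, ← lintegral_const_mul' _ _ ENNReal.ofReal_ne_top]
    refine lintegral_congr_ae ?_
    filter_upwards [hne] with ξ hn
    have e : {r | 0 < r ∧ (r, ξ) ∈ S₁} = Set.Ici (l / ‖ξ‖) := by
      ext r
      simp only [S₁, Set.mem_ofPred_eq, Set.mem_Ici, div_le_iff₀ hn, and_iff_right_iff_imp]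
      exact fun h => pos_of_mul_pos_left (hl.trans_le h) hn.le
    rw [e, lintegral_Ici_rpow (by linarith) (by positivity), mul_left_comm,
      ← ENNReal.ofReal_mul (by positivity)]
    congr 2
    rw [show -2 * s - 1 + 1 = -(2 * s) by ring, Real.div_rpow hl.le hn.le, Real.rpow_neg hn.le]
    field_simp
    ring
  have hI₂ : ∫⁻ r in Set.Ioi 0, ENNReal.ofReal (r ^ (2 * t - 2 * s - 1)) *
      ∫⁻ ξ in {ξ | (r, ξ) ∈ S₂}, ‖(𝓕 φ) ξ‖ₑ ^ 2 * ENNReal.ofReal (‖ξ‖ ^ (2 * t)) =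
      ENNReal.ofReal ((2 * l) ^ (2 * t - 2 * s) / (2 * t - 2 * s)) * J := by
    rw [hT₂, hJ, ← lintegral_const_mul' _ _ ENNReal.ofReal_ne_top]
    refine lintegral_congr_ae ?_
    filter_upwards [hne] with ξ hn
    have e : {r | 0 < r ∧ (r, ξ) ∈ S₂} = Set.Ioo 0 (2 * l / ‖ξ‖) := by
      ext r
      simp [S₂, lt_div_iff₀ hn]
    rw [e, lintegral_Ioo_rpow (by linarith) (by positivity), mul_left_comm, mul_assoc,
      ← ENNReal.ofReal_mul (by positivity), ← ENNReal.ofReal_mul (by positivity)]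
    congr 2
    rw [sub_add_cancel, Real.div_rpow (by positivity) hn.le, Real.rpow_sub hn]
    field_simp
  have hscale (r : ℝ) (hr : 0 < r) :
      ENNReal.ofReal (r ^ (-2 * s - 1)) * ∫⁻ x in {x | δ x ≤ r}, ‖φ x‖ₑ ^ 2 ≤
      2 * (ENNReal.ofReal (r ^ (-2 * s - 1)) * ∫⁻ ξ in {ξ | (r, ξ) ∈ S₁}, ‖(𝓕 φ) ξ‖ₑ ^ 2) +
      ENNReal.ofReal (C * l ^ (-(2 * t))) * (ENNReal.ofReal (r ^ (2 * t - 2 * s - 1)) *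
        ∫⁻ ξ in {ξ | (r, ξ) ∈ S₂}, ‖(𝓕 φ) ξ‖ₑ ^ 2 * ENNReal.ofReal (‖ξ‖ ^ (2 * t))) := by
    have e₁ : {ξ : V | l / r ≤ ‖ξ‖} = {ξ | (r, ξ) ∈ S₁} := by
      ext ξ
      simp [S₁, div_le_iff₀ hr, mul_comm]
    have e₂ : Metric.ball (0 : V) (2 * (l / r)) = {ξ | (r, ξ) ∈ S₂} := by
      ext ξ
      rw [mem_ball_zero_iff, ← mul_div_assoc, lt_div_iff₀ hr, mul_comm]
      rfl
    have h1 := h φ {x | δ x ≤ r} (l / r) (by positivity)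
    rw [e₁, e₂] at h1
    refine (mul_le_mul_right h1 _).trans ?_
    rw [mul_add, mul_left_comm, ← mul_assoc (ENNReal.ofReal (C * _)), ← mul_assoc (ENNReal.ofReal _)]
    refine add_le_add le_rfl (mul_le_mul' ?_ le_rfl)
    -- The factors (r/l)^d and (l/r)^{d-2t} combine to (r/l)^{2t}, independently of d.
    refine (mul_le_mul_right (mul_le_mul_right (hvol r hr) _) _).trans (le_of_eq ?_)
    rw [← ENNReal.ofReal_mul (by positivity), ← ENNReal.ofReal_mul (by positivity),
      ← ENNReal.ofReal_mul (by positivity)]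
    congr 1
    rw [Real.div_rpow hl.le hr.le, Real.div_rpow hr.le hl.le, Real.rpow_sub hl, Real.rpow_sub hr,
      Real.rpow_sub hr, Real.rpow_sub hr, Real.rpow_sub hr, Real.rpow_neg hl.le,
      show -2 * s = -(2 * s) by ring, Real.rpow_neg hr.le]
    field_simp
  calc ∫⁻ x, ‖φ x‖ₑ ^ 2 / ENNReal.ofReal (δ x ^ (2 * s))
      ≤ ENNReal.ofReal (2 * s) * ∫⁻ r in Set.Ioi 0, ENNReal.ofReal (r ^ (-2 * s - 1)) *
        ∫⁻ x in {x | δ x ≤ r}, ‖φ x‖ₑ ^ 2 := lintegral_div_rpow_le hs hδ hδ0 hφ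
    _ ≤ ENNReal.ofReal (2 * s) * ∫⁻ r in Set.Ioi 0,
        (2 * (ENNReal.ofReal (r ^ (-2 * s - 1)) * ∫⁻ ξ in {ξ | (r, ξ) ∈ S₁}, ‖(𝓕 φ) ξ‖ₑ ^ 2) +
        ENNReal.ofReal (C * l ^ (-(2 * t))) * (ENNReal.ofReal (r ^ (2 * t - 2 * s - 1)) *
          ∫⁻ ξ in {ξ | (r, ξ) ∈ S₂}, ‖(𝓕 φ) ξ‖ₑ ^ 2 * ENNReal.ofReal (‖ξ‖ ^ (2 * t)))) := by
        gcongr ?_ * ?_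
        · exact le_rfl
        · exact setLIntegral_mono' measurableSet_Ioi hscale
    _ = ENNReal.ofReal (2 * s) *
        (2 * (ENNReal.ofReal (l ^ (-(2 * s)) / (2 * s)) * J) +
        ENNReal.ofReal (C * l ^ (-(2 * t))) *
          (ENNReal.ofReal ((2 * l) ^ (2 * t - 2 * s) / (2 * t - 2 * s)) * J)) := by
        have hm := ((hg (-2 * s - 1)).mul
          (measurable_setLIntegral_section (μ := volume) hF hS₁)).const_mul 2
        simp only [Pi.mul_apply] at hm
        rw [lintegral_add_left hm,
          lintegral_const_mul' _ _ ENNReal.ofNat_ne_top,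
          lintegral_const_mul' _ _ ENNReal.ofReal_ne_top, hI₁, hI₂]
    _ = _ := by
        rw [← ENNReal.ofReal_ofNat 2, ← mul_assoc, ← mul_assoc, ← add_mul, ← mul_assoc,
          ← ENNReal.ofReal_mul (by positivity), ← ENNReal.ofReal_mul (by positivity),
          ← ENNReal.ofReal_add (by positivity) (by positivity),
          ← ENNReal.ofReal_mul (by positivity)]
        congr 2
        rw [Real.mul_rpow zero_le_two hl.le, Real.rpow_sub hl, Real.rpow_neg hl.le,
          Real.rpow_neg hl.le]
        field_simp

end

/-! ### Passage from test functions to the completion -/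

/-- Lower semicontinuity of weighted `L²` integrals under local `L¹` convergence. -/
theorem TestConvergesLocally.lintegral_mul_le {d : ℕ} {φ : ℕ → 𝓢(EuclideanSpace ℝ (Fin d), ℂ)}
    {v : EuclideanSpace ℝ (Fin d) → ℂ} (h : TestConvergesLocally φ v)
    {W : EuclideanSpace ℝ (Fin d) → ℝ≥0∞} (hW : Measurable W) (hW_fin : ∀ᵐ x, W x ≠ ∞)
    {b : ℕ → ℝ≥0∞} {B : ℝ≥0∞} (hb : Tendsto b atTop (𝓝 B))
    (hφ : ∀ n, ∫⁻ x, ‖φ n x‖ₑ ^ 2 * W x ≤ b n) : ∫⁻ x, ‖v x‖ₑ ^ 2 * W x ≤ B := by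
  have hball (m : ℕ) : ∫⁻ x in Metric.closedBall 0 m, ‖v x‖ₑ ^ 2 * W x ≤ B := by
    -- On a ball, L¹ convergence gives an a.e. convergent subsequence, to which Fatou's lemma
    -- applies.
    have hmeas : TendstoInMeasure (volume.restrict (Metric.closedBall 0 (m : ℝ)))
        (fun n => (φ n : EuclideanSpace ℝ (Fin d) → ℂ)) atTop v := by
      refine tendstoInMeasure_of_tendsto_eLpNorm one_ne_zero
        (fun n => (φ n).continuous.aestronglyMeasurable)
        (h.2.1.aestronglyMeasurable.mono_measure Measure.restrict_le_self) ?_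
      simpa only [eLpNorm_one_eq_lintegral_enorm, Pi.sub_apply] using
        h.2.2 _ (isCompact_closedBall 0 m)
    obtain ⟨ns, hns, hae⟩ := hmeas.exists_seq_tendsto_ae
    calc ∫⁻ x in Metric.closedBall 0 m, ‖v x‖ₑ ^ 2 * W x
        = ∫⁻ x in Metric.closedBall 0 m,
            liminf (fun k => ‖φ (ns k) x‖ₑ ^ 2 * W x) atTop := by
          refine lintegral_congr_ae ?_
          filter_upwards [hae, ae_restrict_of_ae hW_fin] with x hx hWx
          -- Finiteness of W is needed where v vanishes: multiplication by ∞ is not continuous at 0.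
          exact (ENNReal.Tendsto.mul_const (ENNReal.Tendsto.pow hx.enorm)
            (Or.inr hWx)).liminf_eq.symm
      _ ≤ liminf (fun k => ∫⁻ x in Metric.closedBall 0 m, ‖φ (ns k) x‖ₑ ^ 2 * W x) atTop :=
          lintegral_liminf_le fun k =>
            ((φ (ns k)).continuous.measurable.enorm.pow_const 2).mul hW
      _ ≤ liminf (fun k => b (ns k)) atTop :=
          liminf_le_liminf (Eventually.of_forall fun k =>
            (setLIntegral_le_lintegral _ _).trans (hφ (ns k)))
      _ = B := (hb.comp hns.tendsto_atTop).liminf_eq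
  rw [← setLIntegral_univ, ← Metric.iUnion_closedBall_nat 0, setLIntegral_iUnion_of_directed]
  · exact iSup_le hball
  · exact Monotone.directed_le fun i j hij =>
      Metric.closedBall_subset_closedBall (by exact_mod_cast hij)

/-- This is Plancherel; the factor (2π)^{2s} ≥ 1 from the frequency normalization is discarded. -/
theorem lintegral_fourier_le_norm_fracLaplacianSchwartz {d : ℕ} {s : ℝ} (hs : 0 ≤ s)
    (φ : 𝓢(EuclideanSpace ℝ (Fin d), ℂ)) :
    ∫⁻ ξ, ‖(𝓕 φ) ξ‖ₑ ^ 2 * ENNReal.ofReal (‖ξ‖ ^ (2 * s)) ≤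
      ENNReal.ofReal (‖fracLaplacianSchwartz hs φ‖ ^ 2) := by
  have h1 : ‖fracLaplacianSchwartz hs φ‖ = ‖(memLp_fracSymbol_mul_fourier hs φ).toLp _‖ := by
    rw [fracLaplacianSchwartz, ← Lp.norm_fourier_eq, FourierTransform.fourier_fourierInv_eq]
  rw [h1, ENNReal.ofReal_pow (norm_nonneg _), ofReal_norm, Lp.enorm_toLp]
  have h2 := eLpNorm_nnreal_pow_eq_lintegral (μ := (volume : Measure (EuclideanSpace ℝ (Fin d))))
    (f := fun ξ => (((2 * Real.pi * ‖ξ‖) ^ s : ℝ) : ℂ) * (𝓕 φ) ξ) (p := 2) two_ne_zero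
  simp only [NNReal.coe_ofNat, ENNReal.coe_ofNat, ENNReal.rpow_ofNat] at h2
  rw [h2]
  refine lintegral_mono fun ξ => ?_
  rw [enorm_mul, mul_pow, mul_comm]
  gcongr
  rw [← ofReal_norm, Complex.norm_real, Real.norm_of_nonneg (by positivity),
    ← ENNReal.ofReal_pow (by positivity), mul_comm 2 s, Real.rpow_mul (norm_nonneg _),
    Real.rpow_ofNat]
  have : 1 ≤ 2 * Real.pi := by linarith [Real.pi_gt_three]
  gcongr
  exact le_mul_of_one_le_left (norm_nonneg _) this

/-! ### Distance to the nearest point, and conclusion -/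

section

variable {d K : ℕ} (R : Fin K → EuclideanSpace ℝ (Fin d))

theorem measurable_nearestDist : Measurable (nearestDist R) :=
  Measurable.iInf fun k => by fun_prop

theorem exists_nearestDist_eq (hK : 1 ≤ K) (x : EuclideanSpace ℝ (Fin d)) :
    ∃ k, ‖x - R k‖ = nearestDist R x := by
  have : Nonempty (Fin K) := ⟨⟨0, hK⟩⟩
  exact exists_eq_ciInf_of_finite

theorem ae_nearestDist_pos (hd : 0 < d) (hK : 1 ≤ K) : ∀ᵐ x, 0 < nearestDist R x := by
  have : Nonempty (Fin d) := ⟨⟨0, hd⟩⟩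
  filter_upwards [compl_mem_ae_iff.2 ((Set.finite_range R).measure_zero volume)] with x hx
  obtain ⟨k, hk⟩ := exists_nearestDist_eq R hK x
  rw [← hk, norm_pos_iff, sub_ne_zero]
  exact fun h => hx ⟨k, h.symm⟩

/-- The sublevel set is covered by K balls of radius r. This is the source of the K-dependence in
the final constant. -/
theorem volume_nearestDist_le (hK : 1 ≤ K) {r : ℝ} (hr : 0 < r) :
    volume {x | nearestDist R x ≤ r} ≤
      ENNReal.ofReal (K * volume.real (Metric.ball (0 : EuclideanSpace ℝ (Fin d)) 1) * r ^ d) := by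
  have h1 : {x | nearestDist R x ≤ r} ⊆ ⋃ k, Metric.closedBall (R k) r := by
    intro x hx
    obtain ⟨k, hk⟩ := exists_nearestDist_eq R hK x
    exact Set.mem_iUnion.2 ⟨k, mem_closedBall_iff_norm.2 (hk.trans_le hx)⟩
  refine (measure_mono h1).trans ((measure_iUnion_fintype_le _ _).trans (le_of_eq ?_))
  simp only [Measure.addHaar_closedBall _ _ hr.le, finrank_euclideanSpace_fin, Finset.sum_const,
    Finset.card_univ, Fintype.card_fin, nsmul_eq_mul]
  rw [ENNReal.ofReal_mul (by positivity), ENNReal.ofReal_mul (by positivity),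
    ENNReal.ofReal_natCast, ofReal_measureReal measure_ball_lt_top.ne, mul_assoc,
    mul_comm (volume _)]

end

theorem lemma2p7 (d : ℕ) (s : ℝ) (hs : 0 < s) (hsd : s < (d : ℝ) / 2) :
    ∃ c : ℝ, 0 < c ∧
      ∀ v : EuclideanSpace ℝ (Fin d) → ℂ, MemHomSobolev hs.le v →
      ∀ g : Lp ℂ 2 (volume : Measure (EuclideanSpace ℝ (Fin d))), IsFracLaplacian hs.le v g →
      ∀ K : ℕ, 1 ≤ K → ∀ R : Fin K → EuclideanSpace ℝ (Fin d),
        ENNReal.ofReal (c * (K : ℝ) ^ (-(2 * s / (d : ℝ)))) *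
            ∫⁻ x, ‖v x‖ₑ ^ 2 / ENNReal.ofReal (nearestDist R x ^ (2 * s))
          ≤ ENNReal.ofReal (‖g‖ ^ 2) := by
  have hd0 : (0 : ℝ) < d := by linarith
  have hd : 0 < d := by exact_mod_cast hd0
  obtain ⟨C, hC, hHardy⟩ := exists_hardy_schwartz (V := EuclideanSpace ℝ (Fin d)) hs
    (by rw [finrank_euclideanSpace_fin]; linarith)
  set ω := volume.real (Metric.ball (0 : EuclideanSpace ℝ (Fin d)) 1)
  have hω : 0 < ω := ENNReal.toReal_pos (Metric.measure_ball_pos _ _ one_pos).ne' measure_ball_lt_top.ne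
  refine ⟨(C * ω ^ (2 * s / d))⁻¹, by positivity, fun v _ g hg K hK R => ?_⟩
  obtain ⟨φ, hφv, hφg⟩ := hg
  have hK0 : (0 : ℝ) < K := by exact_mod_cast hK
  have hA : 0 < K * ω := by positivity
  -- This is the length l for which Kω r^d = (r/l)^d.
  have hl : 0 < (K * ω) ^ (-(d : ℝ)⁻¹) := by positivity
  have hpos := ae_nearestDist_pos R hd hK
  have hδ := measurable_nearestDist R
  have hvol (r : ℝ) (hr : 0 < r) : volume {x | nearestDist R x ≤ r} ≤ ENNReal.ofReal
      ((r / (K * ω) ^ (-(d : ℝ)⁻¹)) ^ (Module.finrank ℝ (EuclideanSpace ℝ (Fin d)) : ℝ)) := by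
    refine (volume_nearestDist_le R hK hr).trans_eq ?_
    rw [finrank_euclideanSpace_fin, Real.div_rpow hr.le hl.le, ← Real.rpow_mul hA.le, neg_mul,
      inv_mul_cancel₀ hd0.ne', Real.rpow_neg_one, div_inv_eq_mul, Real.rpow_natCast, mul_comm]
  have hbound (n : ℕ) : ∫⁻ x, ‖φ n x‖ₑ ^ 2 * (ENNReal.ofReal (nearestDist R x ^ (2 * s)))⁻¹ ≤
      ENNReal.ofReal (C * ((K * ω) ^ (-(d : ℝ)⁻¹)) ^ (-(2 * s))) *
        ENNReal.ofReal (‖fracLaplacianSchwartz hs.le (φ n)‖ ^ 2) := by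
    refine (hHardy _ hδ hpos _ hl hvol (φ n)).trans ?_
    gcongr
    exact lintegral_fourier_le_norm_fracLaplacianSchwartz hs.le (φ n)
  have hv := hφv.lintegral_mul_le (W := fun x => (ENNReal.ofReal (nearestDist R x ^ (2 * s)))⁻¹)
    (by fun_prop)
    (by
      filter_upwards [hpos] with x hx
      simpa using Real.rpow_pos_of_pos hx _)
    (ENNReal.Tendsto.const_mul (ENNReal.tendsto_ofReal (hφg.norm.pow 2))
      (Or.inr ENNReal.ofReal_ne_top)) hbound
  simp only [div_eq_mul_inv] at hv ⊢
  refine (mul_le_mul_right hv _).trans_eq ?_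
  rw [← mul_assoc, ← ENNReal.ofReal_mul (by positivity)]
  convert one_mul _
  rw [ENNReal.ofReal_eq_one, ← Real.rpow_mul hA.le,
    show -(d : ℝ)⁻¹ * -(2 * s) = 2 * s * (d : ℝ)⁻¹ by ring, Real.mul_rpow hK0.le hω.le,
    Real.rpow_neg hK0.le]
  field_simp
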